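/- Let $q\in L_2(\mathbb{R})$ and $a\in\mathbb{C}$. For $f\in W_2^2(\mathbb{R}\setminus\{0\})$ put $f_r(0)=\tfrac12\,(f(0+)+f(0-))$, $f_s(0)=f(0+)-f(0-)$ and $f_s'(0)=f'(0+)-f'(0-)$, and let $(q,f)=\int_{\mathbb{R}}q(x)^*f(x)\,dx$, where $^*$ denotes complex conjugation. Let $H_a$ be the operator in $L_2(\mathbb{R})$ given by $$H_af=-f''+f_r(0)\,q,\qquad \mathcal{D}(H_a)=\{f\in W_2^2(\mathbb{R}\setminus\{0\}) : f_s(0)=0,\ f_s'(0)=a f_r(0)+(q,f)\},$$ where $f''$ is taken on $\mathbb{R}\setminus\{0\}$. A number $\lambda\in\mathbb{C}$ is called an exceptional point of $H_a$ if it is an eigenvalue of $H_a$ whose geometric multiplicity $\dim\ker(H_a-\lambda I)$ does not coincide with its algebraic multiplicity $\dim\bigcup_{n\ge1}\ker(H_a-\lambda I)^n$. If $\lambda_0$ is an exceptional point of $H_a$, then the complex conjugate $\lambda_0^*$ is an exceptional point of $H_{a^*}$ (with the same $q$). -/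

import Mathlib

open MeasureTheory Filter Topology Set
open scoped ContDiff

namespace NonlocalDelta

/-- The Hilbert space `L₂(ℝ)` of complex valued functions (Lebesgue measure). Its inner product
`inner ℂ f g = ∫ conj f * g` is linear in the second argument. -/
abbrev L2 : Type := Lp ℂ 2 (volume : Measure ℝ)

/-! ### The Sobolev space `W₂²(ℝ ∖ {0})` and one-sided values at `0` -/

/-- `g` is the weak derivative of `f` on the open set `U`: one has `∫ f φ' = - ∫ g φ` for all
smooth functions `φ` with compact support in `U`. -/
def IsWeakDerivOn (U : Set ℝ) (f g : ℝ → ℂ) : Prop :=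
  ∀ φ : ℝ → ℝ, ContDiff ℝ ∞ φ → HasCompactSupport φ → tsupport φ ⊆ U →
    ∫ x, deriv φ x • f x = - ∫ x, φ x • g x

/-- The continuous representative of `f` on the set `s` has the limit `c` at `0` along `s`.
For `s = (0, ∞)` this says `f(0+) = c`, and for `s = (-∞, 0)` it says `f(0-) = c`. -/
def HasTrace (s : Set ℝ) (f : ℝ → ℂ) (c : ℂ) : Prop :=
  ∃ r : ℝ → ℂ, r =ᵐ[volume.restrict s] f ∧ ContinuousOn r s ∧ Tendsto r (𝓝[s] 0) (𝓝 c)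

/-- `f` belongs to `W₂²(ℝ ∖ {0})`, its weak derivatives on `ℝ ∖ {0}` are `f₁ = f'` and
`f₂ = f''`, and `f(0+) = fp`, `f(0-) = fm`, `f'(0+) = dp`, `f'(0-) = dm`. For every `f` in
`W₂²(ℝ ∖ {0})` the other data exist (the restrictions of `f` and `f'` to the two half lines have
representatives that are continuous up to `0`), and they are unique. -/
structure IsW22 (f f₁ f₂ : L2) (fp fm dp dm : ℂ) : Prop where
  weak₁ : IsWeakDerivOn {0}ᶜ f f₁
  weak₂ : IsWeakDerivOn {0}ᶜ f₁ f₂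
  right : HasTrace (Ioi 0) f fp
  left : HasTrace (Iio 0) f fm
  deriv_right : HasTrace (Ioi 0) f₁ dp
  deriv_left : HasTrace (Iio 0) f₁ dm

/-! Linearity and uniqueness of these data. -/

lemma integrable_smul_L2 (f : L2) {ψ : ℝ → ℝ} (hψ : Continuous ψ) (hc : HasCompactSupport ψ) :
    Integrable (fun x => ψ x • f x) := by
  have hf : LocallyIntegrable (f : ℝ → ℂ) volume :=
    (Lp.memLp f).locallyIntegrable (by norm_num)
  exact hf.integrable_smul_left_of_hasCompactSupport hψ hc

lemma IsWeakDerivOn.add {U : Set ℝ} {f g f' g' : L2} (h : IsWeakDerivOn U f g)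
    (h' : IsWeakDerivOn U f' g') :
    IsWeakDerivOn U (f + f' : L2) (g + g' : L2) := by
  intro φ h1 h2 h3
  have hd : Continuous (deriv φ) := h1.continuous_deriv (by simp)
  have e1 : ∫ x, deriv φ x • (f + f' : L2) x
      = ∫ x, (deriv φ x • f x + deriv φ x • f' x) := by
    refine integral_congr_ae ?_
    filter_upwards [Lp.coeFn_add f f'] with x hx
    rw [hx, Pi.add_apply, smul_add]
  have e2 : ∫ x, φ x • (g + g' : L2) x = ∫ x, (φ x • g x + φ x • g' x) := by
    refine integral_congr_ae ?_
    filter_upwards [Lp.coeFn_add g g'] with x hx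
    rw [hx, Pi.add_apply, smul_add]
  rw [e1, e2, integral_add (integrable_smul_L2 f hd h2.deriv) (integrable_smul_L2 f' hd h2.deriv),
    integral_add (integrable_smul_L2 g h1.continuous h2) (integrable_smul_L2 g' h1.continuous h2),
    h φ h1 h2 h3, h' φ h1 h2 h3]
  ring

lemma IsWeakDerivOn.smul {U : Set ℝ} {f g : L2} (h : IsWeakDerivOn U f g) (c : ℂ) :
    IsWeakDerivOn U (c • f : L2) (c • g : L2) := by
  intro φ h1 h2 h3
  have e1 : ∫ x, deriv φ x • (c • f : L2) x = ∫ x, c • (deriv φ x • f x) := by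
    refine integral_congr_ae ?_
    filter_upwards [Lp.coeFn_smul c f] with x hx
    rw [hx, Pi.smul_apply, smul_comm]
  have e2 : ∫ x, φ x • (c • g : L2) x = ∫ x, c • (φ x • g x) := by
    refine integral_congr_ae ?_
    filter_upwards [Lp.coeFn_smul c g] with x hx
    rw [hx, Pi.smul_apply, smul_comm]
  rw [e1, e2, integral_smul, integral_smul, h φ h1 h2 h3, smul_neg]

lemma IsWeakDerivOn.eq_zero {g : L2} (h : IsWeakDerivOn {0}ᶜ (0 : L2) g) : g = 0 := by
  have hg : LocallyIntegrable (g : ℝ → ℂ) volume :=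
    (Lp.memLp g).locallyIntegrable (by norm_num)
  have key := isOpen_compl_singleton.ae_eq_zero_of_integral_contDiff_smul_eq_zero
    (U := ({0}ᶜ : Set ℝ)) (μ := volume) (f := g) (hg.locallyIntegrableOn _) (by
      intro φ h1 h2 h3
      have e : ∫ x, deriv φ x • (0 : L2) x = 0 := by
        rw [← integral_zero ℝ ℂ (μ := volume)]
        refine integral_congr_ae ?_
        filter_upwards [Lp.coeFn_zero ℂ 2 (volume : Measure ℝ)] with x hx
        rw [hx, Pi.zero_apply, smul_zero]
      have := h φ h1 h2 h3
      rw [e] at this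
      exact neg_eq_zero.mp this.symm)
  refine Lp.ext ?_
  have h0 : ∀ᵐ x : ℝ, x ≠ 0 := by simp [ae_iff]
  filter_upwards [key, h0, Lp.coeFn_zero ℂ 2 (volume : Measure ℝ)] with x hx hx0 hz
  rw [hz, hx hx0, Pi.zero_apply]

lemma HasTrace.add {s : Set ℝ} {f f' : L2} {c c' : ℂ} (h : HasTrace s f c)
    (h' : HasTrace s f' c') : HasTrace s (f + f' : L2) (c + c') := by
  obtain ⟨r, h1, h2, h3⟩ := h
  obtain ⟨r', h1', h2', h3'⟩ := h'
  refine ⟨fun x => r x + r' x, ?_, h2.add h2', h3.add h3'⟩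
  filter_upwards [h1, h1', ae_restrict_of_ae (Lp.coeFn_add f f')] with x hx hx' he
  rw [he, Pi.add_apply, hx, hx']

lemma HasTrace.smul {s : Set ℝ} {f : L2} {c : ℂ} (h : HasTrace s f c) (z : ℂ) :
    HasTrace s (z • f : L2) (z * c) := by
  obtain ⟨r, h1, h2, h3⟩ := h
  refine ⟨fun x => z * r x, ?_, continuousOn_const.mul h2, h3.const_mul z⟩
  filter_upwards [h1, ae_restrict_of_ae (Lp.coeFn_smul z f)] with x hx he
  rw [he, Pi.smul_apply, hx, smul_eq_mul]

lemma HasTrace.zero (s : Set ℝ) : HasTrace s (0 : L2) 0 := by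
  refine ⟨fun _ => 0, ?_, continuousOn_const, tendsto_const_nhds⟩
  filter_upwards [ae_restrict_of_ae (Lp.coeFn_zero ℂ 2 (volume : Measure ℝ))] with x hx
  rw [hx, Pi.zero_apply]

lemma HasTrace.unique {s : Set ℝ} (hs : IsOpen s) [(𝓝[s] (0 : ℝ)).NeBot] {f : ℝ → ℂ} {c c' : ℂ}
    (h : HasTrace s f c) (h' : HasTrace s f c') : c = c' := by
  obtain ⟨r, h1, h2, h3⟩ := h
  obtain ⟨r', h1', h2', h3'⟩ := h'
  have he : EqOn r r' s := Measure.eqOn_open_of_ae_eq (h1.trans h1'.symm) hs h2 h2'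
  exact tendsto_nhds_unique (h3.congr' (eventually_nhdsWithin_of_forall he)) h3'

lemma IsW22.zero : IsW22 0 0 0 0 0 0 0 := by
  have hw : IsWeakDerivOn {0}ᶜ (0 : L2) (0 : L2) := by
    have e : ∀ ψ : ℝ → ℝ, ∫ x, ψ x • (0 : L2) x = 0 := by
      intro ψ
      rw [← integral_zero ℝ ℂ (μ := volume)]
      refine integral_congr_ae ?_
      filter_upwards [Lp.coeFn_zero ℂ 2 (volume : Measure ℝ)] with x hx
      rw [hx, Pi.zero_apply, smul_zero]
    intro φ _ _ _
    rw [e, e, neg_zero]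
  exact ⟨hw, hw, .zero _, .zero _, .zero _, .zero _⟩

lemma IsW22.add {f f₁ f₂ g g₁ g₂ : L2} {fp fm dp dm gp gm ep em : ℂ}
    (h : IsW22 f f₁ f₂ fp fm dp dm) (h' : IsW22 g g₁ g₂ gp gm ep em) :
    IsW22 (f + g) (f₁ + g₁) (f₂ + g₂) (fp + gp) (fm + gm) (dp + ep) (dm + em) :=
  ⟨h.weak₁.add h'.weak₁, h.weak₂.add h'.weak₂, h.right.add h'.right, h.left.add h'.left,
    h.deriv_right.add h'.deriv_right, h.deriv_left.add h'.deriv_left⟩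

lemma IsW22.smul {f f₁ f₂ : L2} {fp fm dp dm : ℂ} (h : IsW22 f f₁ f₂ fp fm dp dm) (z : ℂ) :
    IsW22 (z • f) (z • f₁) (z • f₂) (z * fp) (z * fm) (z * dp) (z * dm) :=
  ⟨h.weak₁.smul z, h.weak₂.smul z, h.right.smul z, h.left.smul z, h.deriv_right.smul z,
    h.deriv_left.smul z⟩

/-! ### The operator `H_a` of the nonlocal `δ`-interaction -/

/-- The graph of `H_a`. With `f_r(0) = (f(0+) + f(0-))/2`, `f_s(0) = f(0+) - f(0-)` and
`f'_s(0) = f'(0+) - f'(0-)` it consists of the pairs `(f, -f'' + f_r(0) q)` where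
`f ∈ W₂²(ℝ ∖ {0})` satisfies `f_s(0) = 0` and `f'_s(0) = a f_r(0) + (q, f)`. -/
def opGraph (q : L2) (a : ℂ) : Submodule ℂ (L2 × L2) where
  carrier := {p | ∃ (f₁ f₂ : L2) (fp fm dp dm : ℂ), IsW22 p.1 f₁ f₂ fp fm dp dm ∧
    fp - fm = 0 ∧ dp - dm = a * ((fp + fm) / 2) + inner ℂ q p.1 ∧
    p.2 = -f₂ + ((fp + fm) / 2) • q}
  zero_mem' := ⟨0, 0, 0, 0, 0, 0, IsW22.zero, by simp, by simp, by simp⟩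
  add_mem' := by
    rintro ⟨f, Hf⟩ ⟨g, Hg⟩ ⟨f₁, f₂, fp, fm, dp, dm, h1, h2, h3, h4⟩
      ⟨g₁, g₂, gp, gm, ep, em, k1, k2, k3, k4⟩
    refine ⟨_, _, _, _, _, _, h1.add k1, by linear_combination h2 + k2, ?_, ?_⟩
    · simp only [Prod.fst_add, inner_add_right]
      linear_combination h3 + k3
    · simp only at h4 k4
      simp only [Prod.snd_add, h4, k4]
      module
  smul_mem' := by
    rintro z ⟨f, Hf⟩ ⟨f₁, f₂, fp, fm, dp, dm, h1, h2, h3, h4⟩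
    refine ⟨_, _, _, _, _, _, h1.smul z, by linear_combination z * h2, ?_, ?_⟩
    · simp only [Prod.smul_fst, inner_smul_right]
      linear_combination z * h3
    · simp only at h4
      simp only [Prod.smul_snd, h4]
      module

lemma opGraph_singleValued (q : L2) (a : ℂ) :
    ∀ p : L2 × L2, p ∈ opGraph q a → p.1 = 0 → p.2 = 0 := by
  rintro ⟨f, Hf⟩ ⟨f₁, f₂, fp, fm, dp, dm, h1, -, -, h4⟩ hf
  simp only at h1 h4 hf
  subst hf
  have e1 : f₁ = 0 := h1.weak₁.eq_zero
  have hw := h1.weak₂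
  rw [e1] at hw
  have e2 : f₂ = 0 := hw.eq_zero
  have e3 : fp = 0 := h1.right.unique isOpen_Ioi (.zero _)
  have e4 : fm = 0 := h1.left.unique isOpen_Iio (.zero _)
  simp [h4, e2, e3, e4]

/-- The operator `H_a f = -f'' + f_r(0) q` in `L₂(ℝ)` with the domain
`{f ∈ W₂²(ℝ ∖ {0}) : f_s(0) = 0, f'_s(0) = a f_r(0) + (q, f)}`, as an unbounded (partially
defined) linear operator. -/
noncomputable def nonlocalDelta (q : L2) (a : ℂ) : L2 →ₗ.[ℂ] L2 := (opGraph q a).toLinearPMap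

/-- The graph of `nonlocalDelta q a` is indeed `opGraph q a`. -/
lemma nonlocalDelta_graph (q : L2) (a : ℂ) : (nonlocalDelta q a).graph = opGraph q a :=
  Submodule.toLinearPMap_graph_eq _ (opGraph_singleValued q a)

/-! ### Multiplicities of eigenvalues and exceptional points -/

/-- `ker (T - z)^n` for an unbounded operator `T`: the vectors `f` for which `f`, `(T - z) f`, …,
`(T - z)^(n-1) f` lie in the domain of `T` and `(T - z)^n f = 0`. -/
def kerPow {E : Type*} [AddCommGroup E] [Module ℂ E] (T : E →ₗ.[ℂ] E) (z : ℂ) :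
    ℕ → Submodule ℂ E
  | 0 => ⊥
  | n + 1 =>
    { carrier := {f | ∃ hf : f ∈ T.domain, T ⟨f, hf⟩ - z • f ∈ kerPow T z n}
      zero_mem' := ⟨T.domain.zero_mem, by
        have : T ⟨0, T.domain.zero_mem⟩ = 0 := T.map_zero
        simp [this]⟩
      add_mem' := by
        rintro f g ⟨hf, hf'⟩ ⟨hg, hg'⟩
        refine ⟨T.domain.add_mem hf hg, ?_⟩
        have : T ⟨f + g, T.domain.add_mem hf hg⟩ = T ⟨f, hf⟩ + T ⟨g, hg⟩ :=
          T.map_add ⟨f, hf⟩ ⟨g, hg⟩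
        rw [this, smul_add, add_sub_add_comm]
        exact add_mem hf' hg'
      smul_mem' := by
        rintro c f ⟨hf, hf'⟩
        refine ⟨T.domain.smul_mem c hf, ?_⟩
        have : T ⟨c • f, T.domain.smul_mem c hf⟩ = c • T ⟨f, hf⟩ := T.map_smul c ⟨f, hf⟩
        rw [this, smul_comm z c, ← smul_sub]
        exact Submodule.smul_mem _ c hf' }

/-- `z` is an eigenvalue of `T`: some nonzero `f` in the domain satisfies `T f = z f`. -/
def IsEigenvalue {E : Type*} [AddCommGroup E] [Module ℂ E] (T : E →ₗ.[ℂ] E) (z : ℂ) : Prop :=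
  ∃ f : T.domain, (f : E) ≠ 0 ∧ T f = z • (f : E)

/-- The geometric multiplicity of `z`: the dimension of the eigenspace `ker (T - z)`. -/
noncomputable def geomMult {E : Type*} [AddCommGroup E] [Module ℂ E] (T : E →ₗ.[ℂ] E) (z : ℂ) :
    Cardinal :=
  Module.rank ℂ (kerPow T z 1)

/-- The algebraic multiplicity of `z`: the dimension of the root subspace, the union of the
increasing sequence of subspaces `ker (T - z)^n`. -/
noncomputable def algMult {E : Type*} [AddCommGroup E] [Module ℂ E] (T : E →ₗ.[ℂ] E) (z : ℂ) :
    Cardinal :=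
  Module.rank ℂ (⨆ n, kerPow T z n : Submodule ℂ E)

/-- An exceptional point of `T`: an eigenvalue whose geometric multiplicity does not coincide with
its algebraic multiplicity. -/
def IsExceptionalPoint {E : Type*} [AddCommGroup E] [Module ℂ E] (T : E →ₗ.[ℂ] E) (z : ℂ) : Prop :=
  IsEigenvalue T z ∧ geomMult T z ≠ algMult T z

end NonlocalDelta

namespace NonlocalDelta

/-! ### Primitives of locally integrable functions -/

/-! The engine is a Green identity, `IsW22.green_nonlocal`: for functions continuous at `0` the
pairing of `-f'' + f(0) q` with `g`, minus the pairing of `f` with `-g'' + g(0) q`, is a combination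
of the defect of `f` in the condition for `a` and that of `g` in the condition for `a^*`. Hence
`H_a` and `H_{a^*}` are formally adjoint (`nonlocalDelta_symm`). The full adjoint is never computed.
Instead, pairing with an eigenfunction `g` of `H_a` with `g(0) ≠ 0` decides whether a function
satisfies the condition for `a^*`.

Let `(H_a - λ) f = g ≠ 0` and `(H_a - λ) g = 0`. If `λ` were real, Green's identity for `g` with
itself would make `g` an eigenfunction of `H_{a^*}` too, and pairing it with `(H_a - λ) f` would
give `‖g‖² = 0`. So `λ` is not real, and `g(0) ≠ 0`, since `-u'' = λ u` has only the zero solution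
with zero boundary values. Now solve `-φ'' + q = λ^* φ` with `φ(0) = 1`, and then `-ψ'' - λ^* ψ = φ`
with `ψ(0) = 0`, using `exists_isW22_solution`. Green's identity against `g` puts `φ` in the domain
of `H_{a^*}`. Pairing `φ` with `(H_a - λ) f = g` gives `(g, φ) = 0`, which is exactly what puts `ψ`
in the domain. The eigenspace is spanned by `φ`, so the chain `ψ, φ` separates the two
multiplicities.

The analytic input is that weakly differentiable functions are primitives on each half line, plus
solvability for nonreal spectral parameter. -/

/-- The primitive of `u` with the value `c` at `0`. -/
noncomputable def primitive (c : ℂ) (u : ℝ → ℂ) (x : ℝ) : ℂ := c + ∫ t in (0 : ℝ)..x, u t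

lemma primitive_zero (c : ℂ) (u : ℝ → ℂ) : primitive c u 0 = c := by simp [primitive]

lemma intervalIntegrable_of_locallyIntegrable {u : ℝ → ℂ} (hu : LocallyIntegrable u) (a b : ℝ) :
    IntervalIntegrable u volume a b :=
  (hu.integrableOn_isCompact isCompact_uIcc).intervalIntegrable

lemma continuous_primitive (c : ℂ) {u : ℝ → ℂ} (hu : LocallyIntegrable u) :
    Continuous (primitive c u) :=
  continuous_const.add
    (intervalIntegral.continuous_primitive (fun a b => intervalIntegrable_of_locallyIntegrable hu a b) 0)

lemma absolutelyContinuousOnInterval_const {X : Type*} [PseudoMetricSpace X] (c : X) (a b : ℝ) :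
    AbsolutelyContinuousOnInterval (fun _ : ℝ => c) a b :=
  LipschitzOnWith.absolutelyContinuousOnInterval (K := 0)
    ((LipschitzWith.const c).lipschitzOnWith)

lemma absolutelyContinuousOnInterval_primitive (c : ℂ) {u : ℝ → ℂ} (hu : LocallyIntegrable u)
    (R : ℝ) : AbsolutelyContinuousOnInterval (primitive c u) 0 R := by
  have hi : IntervalIntegrable u volume 0 R := intervalIntegrable_of_locallyIntegrable hu 0 R
  have h1 : IntervalIntegrable (fun x => (u x).re) volume 0 R := ⟨hi.1.re, hi.2.re⟩
  have h2 : IntervalIntegrable (fun x => (u x).im) volume 0 R := ⟨hi.1.im, hi.2.im⟩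
  have k1 := h1.absolutelyContinuousOnInterval_intervalIntegral (c := 0) (by simp)
  have k2 := h2.absolutelyContinuousOnInterval_intervalIntegral (c := 0) (by simp)
  have k := (absolutelyContinuousOnInterval_const c 0 R).add
    ((k1.smul (absolutelyContinuousOnInterval_const (1 : ℂ) 0 R)).add
    (k2.smul (absolutelyContinuousOnInterval_const Complex.I 0 R)))
  have e : primitive c u = (fun _ => c) + ((fun x => ∫ t in (0 : ℝ)..x, (u t).re) • (fun _ => 1) +
      (fun x => ∫ t in (0 : ℝ)..x, (u t).im) • (fun _ => Complex.I)) := by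
    refine funext fun x => ?_
    have hx : IntervalIntegrable u volume 0 x := intervalIntegrable_of_locallyIntegrable hu 0 x
    have e1 : (∫ t in (0 : ℝ)..x, (u t).re) = (∫ t in (0 : ℝ)..x, u t).re :=
      Complex.reCLM.intervalIntegral_comp_comm hx
    have e2 : (∫ t in (0 : ℝ)..x, (u t).im) = (∫ t in (0 : ℝ)..x, u t).im :=
      Complex.imCLM.intervalIntegral_comp_comm hx
    simp only [primitive, Pi.add_apply, Pi.smul_apply', e1, e2, Complex.real_smul, mul_one]
    rw [Complex.re_add_im]
  rw [e]
  exact k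

lemma locallyIntegrable_mul_primitive (c : ℂ) {u v : ℝ → ℂ} (hu : LocallyIntegrable u)
    (hv : LocallyIntegrable v) : LocallyIntegrable (fun x => u x * primitive c v x) := by
  have := (hu.locallyIntegrableOn univ).mul_continuousOn (continuous_primitive c hv).continuousOn
    isOpen_univ.isLocallyClosed
  exact locallyIntegrableOn_univ.1 this

/-- The product rule for primitives. -/
lemma integral_mul_primitive_add (a b : ℂ) {u v : ℝ → ℂ} (hu : LocallyIntegrable u)
    (hv : LocallyIntegrable v) (R : ℝ) :
    ∫ x in (0 : ℝ)..R, (u x * primitive b v x + primitive a u x * v x) =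
      primitive a u R * primitive b v R - a * b := by
  set w : ℝ → ℂ := fun x => u x * primitive b v x + primitive a u x * v x with hw
  have hwi : LocallyIntegrable w := by
    refine (locallyIntegrable_mul_primitive b hu hv).add ?_
    simpa only [mul_comm] using locallyIntegrable_mul_primitive a hv hu
  have hUV := (absolutelyContinuousOnInterval_primitive a hu R).smul
    (absolutelyContinuousOnInterval_primitive b hv R)
  have hac := hUV.sub (absolutelyContinuousOnInterval_primitive 0 hwi R)
  -- By Lebesgue differentiation, the product minus the primitive of its formal derivative has
  -- derivative zero almost everywhere. Being absolutely continuous, it is constant, and its values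
  -- at `0` and `R` are compared.
  obtain ⟨C, hC⟩ := hac.const_of_ae_hasDerivAt_zero (by
    filter_upwards [LocallyIntegrable.ae_hasDerivAt_integral hu,
      LocallyIntegrable.ae_hasDerivAt_integral hv, LocallyIntegrable.ae_hasDerivAt_integral hwi] with x h1 h2 h3 _
    have e1 : HasDerivAt (primitive a u) (u x) x := (h1 0).const_add a
    have e2 : HasDerivAt (primitive b v) (v x) x := (h2 0).const_add b
    have e3 : HasDerivAt (primitive 0 w) (w x) x := (h3 0).const_add 0
    have := (e1.mul e2).sub e3
    rwa [hw, sub_self] at this)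
  have h0 := hC 0 (by simp)
  have hR := hC R (by simp)
  simp only [Pi.sub_apply, Pi.mul_apply, primitive_zero, smul_eq_mul] at h0 hR
  have e : primitive 0 w R = ∫ x in (0 : ℝ)..R, w x := by simp [primitive]
  rw [← e]
  linear_combination h0 - hR

/-- The product rule shows that the product of the primitives has a limit at infinity. That product
is also integrable, so the limit is zero and only the boundary term at `0` survives. -/
lemma integral_Ioi_mul_add {f g u v : ℝ → ℂ} {a b : ℂ} (hf : MemLp f 2) (hg : MemLp g 2)
    (hu : MemLp u 2) (hv : MemLp v 2) (hfa : f =ᵐ[volume.restrict (Ioi 0)] primitive a u)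
    (hgb : g =ᵐ[volume.restrict (Ioi 0)] primitive b v) :
    ∫ x in Ioi (0 : ℝ), (u x * g x + f x * v x) = -(a * b) := by
  have hu' : LocallyIntegrable u := hu.locallyIntegrable (by norm_num)
  have hv' : LocallyIntegrable v := hv.locallyIntegrable (by norm_num)
  have hfg : IntegrableOn (fun x => primitive a u x * primitive b v x) (Ioi 0) :=
    (hf.integrable_mul hg).integrableOn.congr (by
      filter_upwards [hfa, hgb] with x h1 h2
      simp [h1, h2])
  have hae : (fun x => u x * g x + f x * v x) =ᵐ[volume.restrict (Ioi 0)]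
      fun x => u x * primitive b v x + primitive a u x * v x := by
    filter_upwards [hfa, hgb] with x h1 h2
    simp [h1, h2]
  have hw : IntegrableOn (fun x => u x * g x + f x * v x) (Ioi 0) :=
    ((hu.integrable_mul hg).add (hf.integrable_mul hv)).integrableOn
  have ht := intervalIntegral_tendsto_integral_Ioi 0 (hw.congr hae) tendsto_id
  rw [← integral_congr_ae hae] at ht
  have ht' : Tendsto (fun x => primitive a u x * primitive b v x) atTop
      (𝓝 (a * b + ∫ x in Ioi (0 : ℝ), (u x * g x + f x * v x))) := by
    refine (ht.const_add (a * b)).congr fun R => ?_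
    rw [id, integral_mul_primitive_add a b hu' hv']
    ring
  have := IntegrableAtFilter.eq_zero_of_tendsto (μ := volume) ⟨Ioi 0, Ioi_mem_atTop 0, hfg⟩
    (fun s hs => by
      obtain ⟨c, hc⟩ := mem_atTop_sets.1 hs
      exact measure_mono_top (s₁ := Ici c) (fun x hx => hc x hx) (by simp)) ht'
  linear_combination this

lemma integral_Iio_mul_add {f g u v : ℝ → ℂ} {a b : ℂ} (hf : MemLp f 2) (hg : MemLp g 2)
    (hu : MemLp u 2) (hv : MemLp v 2) (hfa : f =ᵐ[volume.restrict (Iio 0)] primitive a u)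
    (hgb : g =ᵐ[volume.restrict (Iio 0)] primitive b v) :
    ∫ x in Iio (0 : ℝ), (u x * g x + f x * v x) = a * b := by
  rw [← integral_Iic_eq_integral_Iio]
  rw [restrict_Iio_eq_restrict_Iic] at hfa hgb
  have hu' : LocallyIntegrable u := hu.locallyIntegrable (by norm_num)
  have hv' : LocallyIntegrable v := hv.locallyIntegrable (by norm_num)
  have hfg : IntegrableOn (fun x => primitive a u x * primitive b v x) (Iic 0) :=
    (hf.integrable_mul hg).integrableOn.congr (by
      filter_upwards [hfa, hgb] with x h1 h2
      simp [h1, h2])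
  have hae : (fun x => u x * g x + f x * v x) =ᵐ[volume.restrict (Iic 0)]
      fun x => u x * primitive b v x + primitive a u x * v x := by
    filter_upwards [hfa, hgb] with x h1 h2
    simp [h1, h2]
  have hw : IntegrableOn (fun x => u x * g x + f x * v x) (Iic 0) :=
    ((hu.integrable_mul hg).add (hf.integrable_mul hv)).integrableOn
  have ht := intervalIntegral_tendsto_integral_Iic 0 (hw.congr hae) tendsto_id
  rw [← integral_congr_ae hae] at ht
  have ht' : Tendsto (fun x => primitive a u x * primitive b v x) atBot
      (𝓝 (a * b - ∫ x in Iic (0 : ℝ), (u x * g x + f x * v x))) := by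
    refine (ht.const_sub (a * b)).congr fun R => ?_
    rw [id, intervalIntegral.integral_symm, integral_mul_primitive_add a b hu' hv']
    ring
  have := IntegrableAtFilter.eq_zero_of_tendsto (μ := volume) ⟨Iic 0, Iic_mem_atBot 0, hfg⟩
    (fun s hs => by
      obtain ⟨c, hc⟩ := mem_atBot_sets.1 hs
      exact measure_mono_top (s₁ := Iic c) (fun x hx => hc x hx) (by simp)) ht'
  linear_combination -this

/-! ### Weak derivatives and primitives -/

lemma primitive_deriv {φ : ℝ → ℝ} (h : ContDiff ℝ ∞ φ) :
    primitive (φ 0) (fun x => ((deriv φ x : ℝ) : ℂ)) = fun x => (φ x : ℂ) := by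
  ext x
  have hd : Continuous (deriv φ) := h.continuous_deriv (by simp)
  have := intervalIntegral.integral_deriv_eq_sub (a := 0) (b := x)
    (fun y _ => (h.differentiable (by simp)).differentiableAt) (hd.intervalIntegrable _ _)
  rw [primitive, intervalIntegral.integral_ofReal, this]
  push_cast
  ring

lemma integrable_smul_of_hasCompactSupport {u : ℝ → ℂ} (hu : LocallyIntegrable u) {ψ : ℝ → ℝ}
    (hψ : Continuous ψ) (hc : HasCompactSupport ψ) : Integrable (fun x => ψ x • u x) :=
  hu.integrable_smul_left_of_hasCompactSupport hψ hc

/-- Integrate by parts over `[-R, 0]` and `[0, R]`: compact support kills the terms at `±R`, and the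
two terms at `0` cancel. -/
lemma integral_deriv_smul_primitive (c : ℂ) {u : ℝ → ℂ} (hu : LocallyIntegrable u) {φ : ℝ → ℝ}
    (h : ContDiff ℝ ∞ φ) (hc : HasCompactSupport φ) :
    ∫ x, deriv φ x • primitive c u x = -∫ x, φ x • u x := by
  have hd : Continuous (deriv φ) := h.continuous_deriv (by simp)
  have i1 := integrable_smul_of_hasCompactSupport
    (continuous_primitive c hu).locallyIntegrable hd hc.deriv
  have i2 := integrable_smul_of_hasCompactSupport hu h.continuous hc
  have hdl : LocallyIntegrable (fun x => ((deriv φ x : ℝ) : ℂ)) :=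
    (Complex.continuous_ofReal.comp hd).locallyIntegrable
  have key : ∀ R : ℝ, ∫ x in (0 : ℝ)..R, (deriv φ x • primitive c u x + φ x • u x) =
      φ R * primitive c u R - φ 0 * c := by
    intro R
    have := integral_mul_primitive_add (φ 0) c hdl hu R
    rw [primitive_deriv h] at this
    simpa only [Complex.real_smul] using this
  have hlim := intervalIntegral_tendsto_integral (i1.add i2) tendsto_neg_atTop_atBot
    (tendsto_id (α := ℝ))
  have hev : ∀ᶠ R : ℝ in atTop, φ R = 0 ∧ φ (-R) = 0 := by
    obtain ⟨r, hr⟩ := hc.isCompact.isBounded.subset_closedBall 0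
    filter_upwards [eventually_gt_atTop r, eventually_gt_atTop 0] with R h1 h2
    constructor <;> refine image_eq_zero_of_notMem_tsupport fun hm => ?_
    all_goals
      have := hr hm
      rw [mem_closedBall_zero_iff] at this
      simp [abs_of_pos h2] at this
      linarith
  have h0 := tendsto_nhds_unique ((tendsto_const_nhds (x := (0 : ℂ))).congr' (by
    filter_upwards [hev] with R hR
    have ii := (i1.add i2).intervalIntegrable (a := -R) (b := 0)
    have ii' := (i1.add i2).intervalIntegrable (a := 0) (b := R)
    have hs := intervalIntegral.integral_add_adjacent_intervals ii ii'
    simp only [Pi.add_apply, id] at hs ⊢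
    rw [← hs, intervalIntegral.integral_symm, key, key, hR.1, hR.2]
    simp)) hlim
  simp only [Pi.add_apply] at h0
  rw [integral_add i1 i2] at h0
  exact eq_neg_of_add_eq_zero_left h0.symm

/-- A smooth compactly supported function on an open interval with vanishing integral is the
derivative of such a function. -/
lemma exists_contDiff_deriv_eq {s : Set ℝ} (hs : IsPreconnected s) {θ : ℝ → ℝ}
    (hθ : ContDiff ℝ ∞ θ) {K : Set ℝ} (hK : IsCompact K) (hne : K.Nonempty) (hKs : K ⊆ s)
    (hsupp : ∀ x ∉ K, θ x = 0) (h0 : ∫ x, θ x = 0) :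
    ∃ φ : ℝ → ℝ, ContDiff ℝ ∞ φ ∧ HasCompactSupport φ ∧ tsupport φ ⊆ s ∧ deriv φ = θ := by
  obtain ⟨a, ha, hal⟩ := hK.exists_isLeast hne
  obtain ⟨b, hb, hbg⟩ := hK.exists_isGreatest hne
  have hab : Icc a b ⊆ s := hs.ordConnected.out (hKs ha) (hKs hb)
  have hz : ∀ x ∉ Icc a b, θ x = 0 := fun x hx => hsupp x fun hxK => hx ⟨hal hxK, hbg hxK⟩
  set φ : ℝ → ℝ := fun x => ∫ t in a..x, θ t with hφ
  have hd : ∀ x, HasDerivAt φ (θ x) x := fun x =>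
    (hθ.continuous.integral_hasStrictDerivAt a x).hasDerivAt
  have hder : deriv φ = θ := funext fun x => (hd x).deriv
  have hout : ∀ x ∉ Icc a b, φ x = 0 := by
    intro x hx
    rcases lt_or_ge x a with hxa | hxa
    · refine (intervalIntegral.integral_congr_ae ?_).trans intervalIntegral.integral_zero
      filter_upwards [(measure_eq_zero_iff_ae_notMem (s := {a})).1 (by simp : volume {a} = 0)]
        with t hta ht
      rw [uIoc_of_ge hxa.le] at ht
      exact hz t fun h => hta (le_antisymm ht.2 h.1)
    · have hxb : b < x := by
        by_contra hh
        exact hx ⟨hxa, not_lt.1 hh⟩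
      simp only [hφ]
      rw [intervalIntegral.integral_of_le hxa, ← integral_Icc_eq_integral_Ioc,
        setIntegral_eq_integral_of_forall_compl_eq_zero, h0]
      exact fun t ht => hz t fun h => ht ⟨h.1, h.2.trans hxb.le⟩
  have hts : tsupport φ ⊆ Icc a b :=
    closure_minimal (fun x hx => by_contra fun h => hx (hout x h)) isClosed_Icc
  refine ⟨φ, ?_, HasCompactSupport.of_support_subset_isCompact isCompact_Icc
    ((subset_tsupport _).trans hts), hts.trans hab, hder⟩
  rw [contDiff_infty_iff_deriv]
  exact ⟨fun x => (hd x).differentiableAt, hder ▸ hθ⟩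

/-- A function with a locally integrable weak derivative is almost everywhere equal to a primitive
of it. -/
lemma IsWeakDerivOn.exists_ae_eq_primitive {U s : Set ℝ} (hs : IsOpen s) (hsc : IsPreconnected s)
    (hne : s.Nonempty) (hsU : s ⊆ U) {f g : ℝ → ℂ} (hf : LocallyIntegrable f)
    (hg : LocallyIntegrable g) (h : IsWeakDerivOn U f g) :
    ∃ c, f =ᵐ[volume.restrict s] primitive c g := by
  obtain ⟨x₀, hx₀⟩ := hne
  obtain ⟨r, hr, hrs⟩ := Metric.isOpen_iff.1 hs x₀ hx₀
  let β : ContDiffBump x₀ := ⟨r / 4, r / 2, by positivity, by linarith⟩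
  set η : ℝ → ℝ := β.normed volume with hη
  have ηsm : ContDiff ℝ ∞ η := β.contDiff_normed
  have ηc : HasCompactSupport η := β.hasCompactSupport_normed
  have ηs : tsupport η ⊆ s := by
    rw [hη, β.tsupport_normed_eq]
    refine (Metric.closedBall_subset_ball ?_).trans hrs
    change r / 2 < r
    linarith
  have ηn : (tsupport η).Nonempty := by
    rw [hη, β.tsupport_normed_eq]
    exact ⟨x₀, Metric.mem_closedBall_self β.rOut_pos.le⟩
  have ηi : ∫ x, η x = 1 := β.integral_normed
  have hP : ∀ c, LocallyIntegrable (primitive c g) := fun c =>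
    (continuous_primitive c hg).locallyIntegrable
  have hv : LocallyIntegrable (fun x => f x - primitive 0 g x) := hf.sub (hP 0)
  have htest : ∀ φ : ℝ → ℝ, ContDiff ℝ ∞ φ → HasCompactSupport φ → tsupport φ ⊆ s →
      ∫ x, deriv φ x • (f x - primitive 0 g x) = 0 := by
    intro φ h1 h2 h3
    have hd : Continuous (deriv φ) := h1.continuous_deriv (by simp)
    simp only [smul_sub]
    rw [integral_sub (integrable_smul_of_hasCompactSupport hf hd h2.deriv)
      (integrable_smul_of_hasCompactSupport (hP 0) hd h2.deriv), h φ h1 h2 (h3.trans hsU),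
      integral_deriv_smul_primitive 0 hg h1 h2, sub_self]
  refine ⟨∫ x, η x • (f x - primitive 0 g x), ?_⟩
  -- The du Bois-Reymond argument: `k` is the `η`-average of `f - primitive 0 g`. For a test
  -- function `ψ` with integral `m`, the function `ψ - m η` has zero mean, so it is the derivative
  -- of a test function.
  set k := ∫ x, η x • (f x - primitive 0 g x) with hk
  have key := hs.ae_eq_zero_of_integral_contDiff_smul_eq_zero (μ := volume)
    (f := fun x => f x - primitive k g x) ((hf.sub (hP k)).locallyIntegrableOn s) (by
      intro ψ p1 p2 p3
      set m : ℝ := ∫ x, ψ x with hm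
      obtain ⟨φ, q1, q2, q3, q4⟩ := exists_contDiff_deriv_eq hsc
        (θ := fun x => ψ x - m * η x) (p1.sub (contDiff_const.mul ηsm))
        (p2.isCompact.union ηc.isCompact) ηn.inr (union_subset p3 ηs)
        (fun x hx => by
          rw [image_eq_zero_of_notMem_tsupport fun hh => hx (Or.inl hh),
            image_eq_zero_of_notMem_tsupport fun hh => hx (Or.inr hh)]
          simp)
        (by
          rw [integral_sub (p1.continuous.integrable_of_hasCompactSupport p2)
            ((ηsm.continuous.integrable_of_hasCompactSupport ηc).const_mul m),
            integral_const_mul, ηi, mul_one, sub_self])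
      have hz := htest φ q1 q2 q3
      have i1 := integrable_smul_of_hasCompactSupport hv p1.continuous p2
      have i2 := integrable_smul_of_hasCompactSupport hv ηsm.continuous ηc
      have i3 : Integrable (fun x => ψ x • k) :=
        (p1.continuous.integrable_of_hasCompactSupport p2).smul_const k
      have e1 : ∫ x, ψ x • (f x - primitive 0 g x) = m • k := by
        rw [q4] at hz
        simp only [sub_smul, mul_smul] at hz
        have i2' : Integrable (fun x => m • η x • (f x - primitive 0 g x)) := i2.smul m
        rw [integral_sub i1 i2', integral_smul, ← hk] at hz
        exact sub_eq_zero.1 hz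
      have e2 : (fun x => ψ x • (f x - primitive k g x)) =
          fun x => ψ x • (f x - primitive 0 g x) - ψ x • k := by
        ext x
        rw [← smul_sub, primitive, primitive]
        congr 1
        ring
      rw [e2, integral_sub i1 i3, e1, integral_smul_const, ← hm, sub_self])
  rw [EventuallyEq, ae_restrict_iff' hs.measurableSet]
  filter_upwards [key] with x hx hxs
  exact sub_eq_zero.1 (hx hxs)

lemma locallyIntegrable_L2 (f : L2) : LocallyIntegrable (f : ℝ → ℂ) :=
  (Lp.memLp f).locallyIntegrable (by norm_num)

lemma hasTrace_of_ae_eq_primitive {s : Set ℝ} {f g : ℝ → ℂ} {c : ℂ} (hg : LocallyIntegrable g)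
    (h : f =ᵐ[volume.restrict s] primitive c g) : HasTrace s f c := by
  have hc := continuous_primitive c hg
  refine ⟨_, h.symm, hc.continuousOn, ?_⟩
  have := hc.tendsto 0
  rw [primitive_zero] at this
  exact this.mono_left nhdsWithin_le_nhds

lemma IsWeakDerivOn.exists_primitive_right {f g : L2} (h : IsWeakDerivOn {0}ᶜ f g) :
    ∃ c, f =ᵐ[volume.restrict (Ioi 0)] primitive c g :=
  h.exists_ae_eq_primitive isOpen_Ioi isPreconnected_Ioi nonempty_Ioi
    (fun _ hx => (ne_of_gt hx)) (locallyIntegrable_L2 f) (locallyIntegrable_L2 g)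

lemma IsWeakDerivOn.exists_primitive_left {f g : L2} (h : IsWeakDerivOn {0}ᶜ f g) :
    ∃ c, f =ᵐ[volume.restrict (Iio 0)] primitive c g :=
  h.exists_ae_eq_primitive isOpen_Iio isPreconnected_Iio nonempty_Iio
    (fun _ hx => (ne_of_lt hx)) (locallyIntegrable_L2 f) (locallyIntegrable_L2 g)

lemma HasTrace.ae_eq_primitive_right {f g : L2} {c : ℂ} (hc : HasTrace (Ioi 0) f c)
    (h : IsWeakDerivOn {0}ᶜ f g) : f =ᵐ[volume.restrict (Ioi 0)] primitive c g := by
  obtain ⟨d, hd⟩ := h.exists_primitive_right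
  rwa [hc.unique isOpen_Ioi (hasTrace_of_ae_eq_primitive (locallyIntegrable_L2 g) hd)]

lemma HasTrace.ae_eq_primitive_left {f g : L2} {c : ℂ} (hc : HasTrace (Iio 0) f c)
    (h : IsWeakDerivOn {0}ᶜ f g) : f =ᵐ[volume.restrict (Iio 0)] primitive c g := by
  obtain ⟨d, hd⟩ := h.exists_primitive_left
  rwa [hc.unique isOpen_Iio (hasTrace_of_ae_eq_primitive (locallyIntegrable_L2 g) hd)]

lemma exists_isW22 {f f₁ f₂ : L2} (h₁ : IsWeakDerivOn {0}ᶜ f f₁) (h₂ : IsWeakDerivOn {0}ᶜ f₁ f₂) :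
    ∃ fp fm dp dm, IsW22 f f₁ f₂ fp fm dp dm := by
  obtain ⟨fp, k1⟩ := h₁.exists_primitive_right
  obtain ⟨fm, k2⟩ := h₁.exists_primitive_left
  obtain ⟨dp, k3⟩ := h₂.exists_primitive_right
  obtain ⟨dm, k4⟩ := h₂.exists_primitive_left
  exact ⟨fp, fm, dp, dm, h₁, h₂, hasTrace_of_ae_eq_primitive (locallyIntegrable_L2 _) k1,
    hasTrace_of_ae_eq_primitive (locallyIntegrable_L2 _) k2,
    hasTrace_of_ae_eq_primitive (locallyIntegrable_L2 _) k3,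
    hasTrace_of_ae_eq_primitive (locallyIntegrable_L2 _) k4⟩

/-! ### Green's identity -/

lemma star_primitive {u : ℝ → ℂ} (c : ℂ) (x : ℝ) :
    star (primitive c u x) = primitive (star c) (star u) x := by
  simp only [primitive, star_add, Pi.star_apply, intervalIntegral, star_sub]
  simp only [← starRingEnd_apply, integral_conj]

/-- Integration by parts for `conj f` and `g` on each half line; the traces fix the constants of the
primitives. -/
lemma inner_add_inner_eq {f f₁ g g₁ : L2} {fp fm gp gm : ℂ}
    (hf : IsWeakDerivOn {0}ᶜ f f₁) (hg : IsWeakDerivOn {0}ᶜ g g₁) (hfp : HasTrace (Ioi 0) f fp)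
    (hfm : HasTrace (Iio 0) f fm) (hgp : HasTrace (Ioi 0) g gp) (hgm : HasTrace (Iio 0) g gm) :
    inner ℂ f₁ g + inner ℂ f g₁ = star fm * gm - star fp * gp := by
  have mf := (Lp.memLp f).star
  have mf₁ := (Lp.memLp f₁).star
  have mg := Lp.memLp g
  have mg₁ := Lp.memLp g₁
  have hr := integral_Ioi_mul_add (a := star fp) (b := gp) mf mg mf₁ mg₁ (by
    filter_upwards [hfp.ae_eq_primitive_right hf] with x hx
    rw [Pi.star_apply, hx, star_primitive]) (hgp.ae_eq_primitive_right hg)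
  have hl := integral_Iio_mul_add (a := star fm) (b := gm) mf mg mf₁ mg₁ (by
    filter_upwards [hfm.ae_eq_primitive_left hf] with x hx
    rw [Pi.star_apply, hx, star_primitive]) (hgm.ae_eq_primitive_left hg)
  have i1 := mf₁.integrable_mul mg
  have i2 := mf.integrable_mul mg₁
  have hs := integral_add_compl (measurableSet_Ioi (a := (0 : ℝ))) (i1.add i2)
  rw [compl_Ioi, integral_Iic_eq_integral_Iio] at hs
  simp only [Pi.add_apply, Pi.mul_apply] at hs
  rw [hr, hl] at hs
  rw [L2.inner_def, L2.inner_def, ← integral_add (L2.integrable_inner _ _)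
    (L2.integrable_inner _ _)]
  have e : ∀ x, inner ℂ (f₁ x) (g x) + inner ℂ (f x) (g₁ x) =
      (star (f₁ : ℝ → ℂ)) x * g x + (star (f : ℝ → ℂ)) x * g₁ x := by
    intro x
    simp only [RCLike.inner_apply', Pi.star_apply, starRingEnd_apply]
  simp only [e, ← hs]
  ring

/-- Green's identity on `ℝ ∖ {0}`. -/
lemma IsW22.green {f f₁ f₂ g g₁ g₂ : L2} {fp fm dp dm gp gm ep em : ℂ}
    (h : IsW22 f f₁ f₂ fp fm dp dm) (k : IsW22 g g₁ g₂ gp gm ep em) :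
    inner ℂ f₂ g - inner ℂ f g₂ =
      star dm * gm - star dp * gp - (star fm * em - star fp * ep) := by
  have e1 := inner_add_inner_eq h.weak₂ k.weak₁ h.deriv_right h.deriv_left k.right k.left
  have e2 := inner_add_inner_eq h.weak₁ k.weak₂ h.right h.left k.deriv_right k.deriv_left
  -- The pairing of `f'` with `g'` occurs in both identities and cancels.
  linear_combination e1 - e2

/-! ### The equation `-u'' - μ u = v` on `ℝ ∖ {0}` for nonreal `μ` -/

lemma memLp_ofReal_of_hasCompactSupport {ψ : ℝ → ℝ} (h : Continuous ψ) (hc : HasCompactSupport ψ) :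
    MemLp (fun x => ((ψ x : ℝ) : ℂ)) 2 volume :=
  (h.memLp_of_hasCompactSupport hc).ofReal

/-- A continuous function with compact support as an element of `L₂(ℝ)`. -/
noncomputable def ofCompactSupport (ψ : ℝ → ℝ) (h : Continuous ψ) (hc : HasCompactSupport ψ) : L2 :=
  (memLp_ofReal_of_hasCompactSupport h hc).toLp

lemma inner_ofCompactSupport {ψ : ℝ → ℝ} (h : Continuous ψ) (hc : HasCompactSupport ψ) (f : L2) :
    inner ℂ (ofCompactSupport ψ h hc) f = ∫ x, ψ x • f x := by
  rw [L2.inner_def]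
  refine integral_congr_ae ?_
  filter_upwards [(memLp_ofReal_of_hasCompactSupport h hc).coeFn_toLp] with x hx
  rw [ofCompactSupport, hx, RCLike.inner_apply', Complex.conj_ofReal, Complex.real_smul]

/-- In this form each test function imposes an equation between continuous functionals, so the
Sobolev graph is closed, hence complete, and the embedding has an adjoint. -/
lemma isWeakDerivOn_iff {U : Set ℝ} {f g : L2} : IsWeakDerivOn U f g ↔
    ∀ (φ : ℝ → ℝ) (h : ContDiff ℝ ∞ φ) (hc : HasCompactSupport φ), tsupport φ ⊆ U →
      inner ℂ (ofCompactSupport (deriv φ) (h.continuous_deriv (by simp)) hc.deriv) f =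
        -inner ℂ (ofCompactSupport φ h.continuous hc) g := by
  simp only [inner_ofCompactSupport]
  rfl

lemma isWeakDerivOn_ofCompactSupport {φ : ℝ → ℝ} (h : ContDiff ℝ ∞ φ) (hc : HasCompactSupport φ)
    (U : Set ℝ) : IsWeakDerivOn U (ofCompactSupport φ h.continuous hc)
      (ofCompactSupport (deriv φ) (h.continuous_deriv (by simp)) hc.deriv) := by
  intro ψ h1 h2 _
  have hd : Continuous (deriv φ) := h.continuous_deriv (by simp)
  have := integral_deriv_smul_primitive (φ 0) (u := fun x => ((deriv φ x : ℝ) : ℂ))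
    (Complex.continuous_ofReal.comp hd).locallyIntegrable h1 h2
  rw [primitive_deriv h] at this
  convert this using 1
  · refine integral_congr_ae ?_
    filter_upwards [(memLp_ofReal_of_hasCompactSupport h.continuous hc).coeFn_toLp] with x hx
    rw [ofCompactSupport, hx]
  · congr 1
    refine integral_congr_ae ?_
    filter_upwards [(memLp_ofReal_of_hasCompactSupport hd hc.deriv).coeFn_toLp] with x hx
    rw [ofCompactSupport, hx]

/-- The Sobolev space `W₂¹(U)`, realized as the space of pairs `(f, f')`. -/
noncomputable def sobolevGraph (U : Set ℝ) : Submodule ℂ (WithLp 2 (L2 × L2)) where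
  carrier := {p | IsWeakDerivOn U p.fst p.snd}
  zero_mem' := by
    rw [mem_ofPred_eq, isWeakDerivOn_iff]
    simp
  add_mem' := fun h k => IsWeakDerivOn.add h k
  smul_mem' := fun c _ h => IsWeakDerivOn.smul h c

lemma isClosed_sobolevGraph (U : Set ℝ) :
    IsClosed (sobolevGraph U : Set (WithLp 2 (L2 × L2))) := by
  have : (sobolevGraph U : Set (WithLp 2 (L2 × L2))) =
      {p | ∀ (φ : ℝ → ℝ) (h : ContDiff ℝ ∞ φ) (hc : HasCompactSupport φ), tsupport φ ⊆ U →
      inner ℂ (ofCompactSupport (deriv φ) (h.continuous_deriv (by simp)) hc.deriv)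
        (WithLp.fstL 2 ℂ L2 L2 p) =
        -inner ℂ (ofCompactSupport φ h.continuous hc) (WithLp.sndL 2 ℂ L2 L2 p)} := by
    ext p
    exact isWeakDerivOn_iff
  rw [this]
  simp only [ofPred_forall]
  refine isClosed_iInter fun φ => isClosed_iInter fun h => isClosed_iInter fun hc =>
    isClosed_iInter fun _ => isClosed_eq ?_ ?_ <;> fun_prop

instance (U : Set ℝ) : CompleteSpace (sobolevGraph U) :=
  (isClosed_sobolevGraph U).completeSpace_coe

/-- The embedding of `W₂¹(U)` into `L₂(ℝ)`. -/
noncomputable def sobolevEmbedding (U : Set ℝ) : sobolevGraph U →L[ℂ] L2 :=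
  (WithLp.fstL 2 ℂ L2 L2).comp (sobolevGraph U).subtypeL

/-- The adjoint of the embedding produces the Riesz representative of pairing with `v` in `W₂¹(U)`.
Testing against pairs `(φ, φ')` says that `-w'' + w = v` weakly. -/
lemma isWeakDerivOn_snd_adjoint (U : Set ℝ) (v : L2) :
    let w := (ContinuousLinearMap.adjoint (sobolevEmbedding U) v : WithLp 2 (L2 × L2))
    IsWeakDerivOn U w.snd (w.fst - v : L2) := by
  intro w
  refine isWeakDerivOn_iff.2 fun φ h hc hU => ?_
  let p : sobolevGraph U := ⟨WithLp.toLp 2 (ofCompactSupport φ h.continuous hc,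
    ofCompactSupport (deriv φ) (h.continuous_deriv (by simp)) hc.deriv),
    isWeakDerivOn_ofCompactSupport h hc U⟩
  have := ContinuousLinearMap.adjoint_inner_right (sobolevEmbedding U) p v
  rw [Submodule.coe_inner, WithLp.prod_inner_apply] at this
  change inner ℂ (ofCompactSupport φ h.continuous hc) w.fst +
    inner ℂ (ofCompactSupport (deriv φ) (h.continuous_deriv (by simp)) hc.deriv) w.snd =
    inner ℂ (ofCompactSupport φ h.continuous hc) v at this
  rw [inner_sub_right]
  linear_combination this

/-- With `j` the embedding, `K = j j*` is self-adjoint and bounded and inverts `1 - d²/dx²` weakly.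
The nonreal number `(1 + μ)⁻¹` is outside its spectrum. -/
lemma exists_weak_solution {μ : ℂ} (hμ : μ.im ≠ 0) (U : Set ℝ) (v : L2) :
    ∃ u u₁ : L2, IsWeakDerivOn U u u₁ ∧ IsWeakDerivOn U u₁ (-(μ • u) - v : L2) := by
  set K : L2 →L[ℂ] L2 := (sobolevEmbedding U).comp
    (ContinuousLinearMap.adjoint (sobolevEmbedding U)) with hK
  have hsa : IsSelfAdjoint K := by
    rw [ContinuousLinearMap.isSelfAdjoint_iff', hK, ContinuousLinearMap.adjoint_comp,
      ContinuousLinearMap.adjoint_adjoint]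
  have hc : (1 + μ).im ≠ 0 := by simpa using hμ
  have hc0 : 1 + μ ≠ 0 := fun h => hc (by rw [h]; rfl)
  have hunit : IsUnit (algebraMap ℂ (L2 →L[ℂ] L2) (1 + μ)⁻¹ - K) := by
    by_contra hh
    have := hsa.im_eq_zero_of_mem_spectrum (spectrum.mem_iff.2 hh)
    rw [Complex.inv_im, div_eq_zero_iff, neg_eq_zero] at this
    exact this.elim hc fun h => hc0 (Complex.normSq_eq_zero.1 h)
  obtain ⟨T, hT⟩ := hunit.exists_right_inv
  -- Then `z = (1 + μ) K z + v`, so `w = j* z` has `w'' = w - z = -μ w - v`.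
  obtain ⟨z, hzz⟩ : ∃ z, (1 + μ)⁻¹ • z - K z = (1 + μ)⁻¹ • v :=
    ⟨T ((1 + μ)⁻¹ • v), by
      simpa [Algebra.algebraMap_eq_smul_one, smul_sub] using DFunLike.congr_fun hT ((1 + μ)⁻¹ • v)⟩
  set w := ContinuousLinearMap.adjoint (sobolevEmbedding U) z with hw
  refine ⟨(w : WithLp 2 (L2 × L2)).fst, (w : WithLp 2 (L2 × L2)).snd, w.2, ?_⟩
  have hKz : K z = (w : WithLp 2 (L2 × L2)).fst := rfl
  have h2 := isWeakDerivOn_snd_adjoint U z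
  have e : (w : WithLp 2 (L2 × L2)).fst - z = -(μ • (w : WithLp 2 (L2 × L2)).fst) - v := by
    rw [← hKz]
    have h3 := congrArg (fun y => (1 + μ) • y) hzz
    simp only [smul_sub, smul_inv_smul₀ hc0] at h3
    rw [← h3]
    module
  rw [← e]
  exact h2

/-! ### Exponentials supported on a half line -/

lemma memLp_indicator_exp {s : Set ℝ} (hs : MeasurableSet s) {z : ℂ}
    (h : IntegrableOn (fun x : ℝ => Real.exp (2 * z.re * x)) s) :
    MemLp (s.indicator fun x : ℝ => Complex.exp (z * x)) 2 volume := by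
  rw [memLp_indicator_iff_restrict hs, memLp_two_iff_integrable_sq_norm (by fun_prop)]
  refine h.congr (Eventually.of_forall fun x => ?_)
  simp only [Complex.norm_exp, ← Real.exp_nat_mul]
  simp
  ring

lemma isWeakDerivOn_indicator_exp {s : Set ℝ} (hs : MeasurableSet s) (z : ℂ)
    (h : MemLp (s.indicator fun x : ℝ => Complex.exp (z * x)) 2 volume)
    (hint : ∀ ψ : ℝ → ℂ, ContDiff ℝ 1 ψ → HasCompactSupport ψ → ψ 0 = 0 → ∫ x in s, deriv ψ x = 0) :
    IsWeakDerivOn {0}ᶜ (h.toLp) (z • h.toLp : L2) := by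
  intro φ h1 h2 h3
  have hd : Continuous (deriv φ) := h1.continuous_deriv (by simp)
  have hexp : ∀ x : ℝ, HasDerivAt (fun x : ℝ => Complex.exp (z * x)) (z * Complex.exp (z * x)) x := by
    intro x
    have := ((Complex.ofRealCLM.hasDerivAt (x := x)).const_mul z).cexp
    simpa [mul_comm] using this
  have hexpc : Continuous fun x : ℝ => Complex.exp (z * x) := by fun_prop
  have hder : ∀ x, HasDerivAt (fun x => φ x • Complex.exp (z * x))
      (φ x • (z * Complex.exp (z * x)) + deriv φ x • Complex.exp (z * x)) x := fun x =>
    ((h1.differentiable (by simp)) x).hasDerivAt.smul (hexp x)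
  have h0 : φ 0 = 0 := image_eq_zero_of_notMem_tsupport fun hh => h3 hh rfl
  have hψ := hint (fun x => φ x • Complex.exp (z * x))
    ((h1.of_le (by simp)).smul (contDiff_const.mul Complex.ofRealCLM.contDiff).cexp) h2.smul_right (by simp [h0])
  have i1 : Integrable (fun x => φ x • (z * Complex.exp (z * x))) :=
    (h1.continuous.smul (continuous_const.mul hexpc)).integrable_of_hasCompactSupport h2.smul_right
  have i2 : Integrable (fun x => deriv φ x • Complex.exp (z * x)) :=
    (hd.smul hexpc).integrable_of_hasCompactSupport h2.deriv.smul_right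
  simp only [fun x => (hder x).deriv] at hψ
  rw [integral_add i1.integrableOn i2.integrableOn] at hψ
  have e1 : ∫ x, deriv φ x • (h.toLp : L2) x = ∫ x in s, deriv φ x • Complex.exp (z * x) := by
    rw [← integral_indicator hs]
    refine integral_congr_ae ?_
    filter_upwards [h.coeFn_toLp] with x hx
    rw [hx]
    by_cases hxs : x ∈ s <;> simp [hxs]
  have e2 : ∫ x, φ x • (z • h.toLp : L2) x = ∫ x in s, φ x • (z * Complex.exp (z * x)) := by
    rw [← integral_indicator hs]
    refine integral_congr_ae ?_
    filter_upwards [h.coeFn_toLp, Lp.coeFn_smul z h.toLp] with x hx hx'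
    rw [hx', Pi.smul_apply, hx]
    by_cases hxs : x ∈ s <;> simp [hxs]
  rw [e1, e2]
  linear_combination hψ

lemma hasTrace_indicator_exp_self {s : Set ℝ} (hs : MeasurableSet s) (z : ℂ)
    (h : MemLp (s.indicator fun x : ℝ => Complex.exp (z * x)) 2 volume) :
    HasTrace s h.toLp 1 := by
  have hexpc : Continuous fun x : ℝ => Complex.exp (z * x) := by fun_prop
  refine ⟨fun x : ℝ => Complex.exp (z * x), ?_, hexpc.continuousOn, ?_⟩
  · filter_upwards [ae_restrict_of_ae h.coeFn_toLp, ae_restrict_mem hs] with x hx hxs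
    simp [hx, hxs]
  · have := (hexpc.tendsto 0).mono_left (nhdsWithin_le_nhds (s := s))
    simpa using this

lemma hasTrace_indicator_exp_of_disjoint {s t : Set ℝ} (ht : MeasurableSet t) (hst : Disjoint s t)
    (z : ℂ) (h : MemLp (s.indicator fun x : ℝ => Complex.exp (z * x)) 2 volume) :
    HasTrace t h.toLp 0 := by
  refine ⟨fun _ => 0, ?_, continuousOn_const, tendsto_const_nhds⟩
  filter_upwards [ae_restrict_of_ae h.coeFn_toLp, ae_restrict_mem ht] with x hx hxt
  simp [hx, hst.notMem_of_mem_right hxt]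

/-- Decaying exponentials on one half line, extended by zero, are homogeneous solutions that adjust
one one-sided value without touching the other. -/
lemma exists_isW22_exp_right {κ : ℂ} (hκ : 0 < κ.re) :
    ∃ (u u₁ : L2) (d : ℂ), IsW22 u u₁ (κ ^ 2 • u) 1 0 d 0 := by
  have hm : MemLp ((Ioi 0).indicator fun x : ℝ => Complex.exp (-κ * x)) 2 volume :=
    memLp_indicator_exp measurableSet_Ioi
      (integrableOn_exp_mul_Ioi (a := 2 * (-κ).re) (by simpa using hκ) 0)
  have hw := isWeakDerivOn_indicator_exp measurableSet_Ioi (-κ) hm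
    fun ψ h1 h2 h0 => by rw [h2.integral_Ioi_deriv_eq h1, h0, neg_zero]
  have hr := hasTrace_indicator_exp_self measurableSet_Ioi (-κ) hm
  have hl := hasTrace_indicator_exp_of_disjoint measurableSet_Iio
    (disjoint_left.2 fun x (h : 0 < x) (h' : x < 0) => lt_asymm h h') (-κ) hm
  refine ⟨hm.toLp, -κ • hm.toLp, -κ * 1, hw, ?_, hr, hl, hr.smul _, ?_⟩
  · have := hw.smul (-κ)
    rwa [smul_smul (-κ) (-κ), neg_mul_neg, ← sq] at this
  · rw [← mul_zero (-κ)]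
    exact hl.smul (-κ)

lemma exists_isW22_exp_left {κ : ℂ} (hκ : 0 < κ.re) :
    ∃ (u u₁ : L2) (d : ℂ), IsW22 u u₁ (κ ^ 2 • u) 0 1 0 d := by
  have hm : MemLp ((Iio 0).indicator fun x : ℝ => Complex.exp (κ * x)) 2 volume :=
    memLp_indicator_exp measurableSet_Iio
      ((integrableOn_exp_mul_Iic (a := 2 * κ.re) (by simpa using hκ) 0).mono_set Iio_subset_Iic_self)
  have hw := isWeakDerivOn_indicator_exp measurableSet_Iio κ hm
    fun ψ h1 h2 h0 => by
      rw [← integral_Iic_eq_integral_Iio, h2.integral_Iic_deriv_eq h1, h0]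
  have hl := hasTrace_indicator_exp_self measurableSet_Iio κ hm
  have hr := hasTrace_indicator_exp_of_disjoint measurableSet_Ioi
    (disjoint_left.2 fun x (h : x < 0) (h' : 0 < x) => lt_asymm h h') κ hm
  refine ⟨hm.toLp, κ • hm.toLp, κ * 1, hw, ?_, hr, hl, ?_, hl.smul _⟩
  · have := hw.smul κ
    rwa [smul_smul κ κ, ← sq] at this
  · rw [← mul_zero κ]
    exact hr.smul κ

lemma exists_sq_eq_re_pos {w : ℂ} (hw : w.im ≠ 0) : ∃ κ : ℂ, 0 < κ.re ∧ κ ^ 2 = w := by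
  obtain ⟨κ, hκ⟩ := IsAlgClosed.exists_pow_nat_eq w (n := 2) (by norm_num)
  have h0 : κ.re ≠ 0 := by
    intro h
    apply hw
    rw [← hκ, sq, Complex.mul_im, h]
    ring
  rcases lt_or_gt_of_ne h0 with h | h
  · exact ⟨-κ, by simpa using h, by rw [neg_sq, hκ]⟩
  · exact ⟨κ, h, hκ⟩

/-- For nonreal `μ` the equation `-u'' - μ u = v` on `ℝ ∖ {0}` has a solution in `W₂²(ℝ ∖ {0})`
with prescribed one-sided values at `0`. -/
lemma exists_isW22_solution {μ : ℂ} (hμ : μ.im ≠ 0) (v : L2) (cp cm : ℂ) :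
    ∃ (u u₁ : L2) (dp dm : ℂ), IsW22 u u₁ (-(μ • u) - v) cp cm dp dm := by
  obtain ⟨u, u₁, h1, h2⟩ := exists_weak_solution hμ {0}ᶜ v
  obtain ⟨fp, fm, dp, dm, hu⟩ := exists_isW22 h1 h2
  obtain ⟨κ, hκ, hκ2⟩ := exists_sq_eq_re_pos (w := -μ) (by simpa using hμ)
  obtain ⟨r, r₁, d, hr⟩ := exists_isW22_exp_right hκ
  obtain ⟨l, l₁, e, hl⟩ := exists_isW22_exp_left hκ
  have := (hu.add (hr.smul (cp - fp))).add (hl.smul (cm - fm))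
  rw [hκ2] at this
  refine ⟨u + (cp - fp) • r + (cm - fm) • l, u₁ + (cp - fp) • r₁ + (cm - fm) • l₁,
    dp + (cp - fp) * d + (cm - fm) * 0, dm + (cp - fp) * 0 + (cm - fm) * e, ?_⟩
  convert this using 1
  · module
  · ring
  · ring

/-! ### Root subspaces of unbounded operators -/

section RootSubspace

variable {E : Type*} [AddCommGroup E] [Module ℂ E] {T : E →ₗ.[ℂ] E} {z : ℂ}

lemma mem_kerPow_succ {n : ℕ} {f : E} :
    f ∈ kerPow T z (n + 1) ↔ ∃ g, (f, g) ∈ T.graph ∧ g - z • f ∈ kerPow T z n := by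
  constructor
  · rintro ⟨hf, h⟩
    exact ⟨T ⟨f, hf⟩, T.mem_graph ⟨f, hf⟩, h⟩
  · rintro ⟨g, hg, h⟩
    obtain ⟨y, hy, rfl⟩ := T.mem_graph_iff.1 hg
    simp only at hy
    subst hy
    exact ⟨y.2, h⟩

lemma mem_kerPow_one {f : E} : f ∈ kerPow T z 1 ↔ (f, z • f) ∈ T.graph := by
  rw [mem_kerPow_succ]
  constructor
  · rintro ⟨g, hg, h⟩
    rwa [← sub_eq_zero.1 ((Submodule.mem_bot ℂ).1 h)]
  · intro h
    exact ⟨_, h, by rw [sub_self]; exact zero_mem _⟩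

lemma kerPow_le_succ (n : ℕ) : kerPow T z n ≤ kerPow T z (n + 1) := by
  induction n with
  | zero => exact bot_le
  | succ n ih =>
    intro f hf
    obtain ⟨g, hg, h⟩ := mem_kerPow_succ.1 hf
    exact mem_kerPow_succ.2 ⟨g, hg, ih h⟩

lemma isEigenvalue_of_mem_graph {f : E} (hf : f ≠ 0) (h : (f, z • f) ∈ T.graph) :
    IsEigenvalue T z := by
  obtain ⟨y, hy, hTy⟩ := T.mem_graph_iff.1 h
  simp only at hy hTy
  subst hy
  exact ⟨y, hf, hTy⟩

/-- At an exceptional point there is a Jordan chain of length two. -/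
lemma IsExceptionalPoint.exists_chain (h : IsExceptionalPoint T z) :
    ∃ f g : E, g ≠ 0 ∧ (g, z • g) ∈ T.graph ∧ (f, z • f + g) ∈ T.graph := by
  -- Otherwise the kernels stabilize at the first power and the two multiplicities agree.
  have h2 : ¬ kerPow T z 2 ≤ kerPow T z 1 := by
    intro hle
    have hn : ∀ n, kerPow T z (n + 1) ≤ kerPow T z 1 := by
      intro n
      induction n with
      | zero => exact le_rfl
      | succ n ih =>
        intro f hf
        obtain ⟨g, hg, hgn⟩ := mem_kerPow_succ.1 hf
        exact hle (mem_kerPow_succ.2 ⟨g, hg, ih hgn⟩)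
    have he : (⨆ n, kerPow T z n : Submodule ℂ E) = kerPow T z 1 :=
      le_antisymm (iSup_le fun n => (kerPow_le_succ n).trans (hn n))
        (le_iSup (fun n => kerPow T z n) 1)
    exact h.2 (by rw [geomMult, algMult, he])
  obtain ⟨f, hf2, hf1⟩ := SetLike.not_le_iff_exists.1 h2
  obtain ⟨g, hg, hgk⟩ := mem_kerPow_succ.1 hf2
  refine ⟨f, g - z • f, fun h0 => hf1 ?_, mem_kerPow_one.1 hgk, by rwa [add_sub_cancel]⟩
  rw [mem_kerPow_one, ← sub_eq_zero.1 h0]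
  exact hg

/-- A spanning eigenvector makes the eigenspace finite dimensional, so equal ranks would force it to
equal the root subspace. Then `f` would be an eigenvector and `g` would vanish. -/
lemma isExceptionalPoint_of_chain {f g : E} (hg : g ≠ 0) (hgk : (g, z • g) ∈ T.graph)
    (hf : (f, z • f + g) ∈ T.graph) (hspan : ∀ k, (k, z • k) ∈ T.graph → ∃ c : ℂ, k = c • g) :
    IsExceptionalPoint T z := by
  refine ⟨isEigenvalue_of_mem_graph hg hgk, fun heq => ?_⟩
  have hle : kerPow T z 1 ≤ ℂ ∙ g := fun k hk => by
    obtain ⟨c, rfl⟩ := hspan k (mem_kerPow_one.1 hk)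
    exact Submodule.smul_mem _ _ (Submodule.mem_span_singleton_self g)
  have hfin : FiniteDimensional ℂ (kerPow T z 1) := Submodule.finiteDimensional_of_le hle
  have hsup : kerPow T z 1 ≤ ⨆ n, kerPow T z n := le_iSup (fun n => kerPow T z n) 1
  have hfin' : FiniteDimensional ℂ (⨆ n, kerPow T z n : Submodule ℂ E) := by
    rw [FiniteDimensional, ← Module.rank_lt_aleph0_iff]
    exact lt_of_eq_of_lt heq.symm (Module.rank_lt_aleph0 ℂ (kerPow T z 1))
  have he := Submodule.eq_of_le_of_finrank_eq hsup (congrArg Cardinal.toNat heq)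
  have hf2 : f ∈ kerPow T z 2 :=
    mem_kerPow_succ.2 ⟨_, hf, by rw [add_sub_cancel_left]; exact mem_kerPow_one.2 hgk⟩
  have hf1 : f ∈ kerPow T z 1 := by
    rw [he]
    exact (le_iSup (fun n => kerPow T z n) 2) hf2
  have := T.graph.sub_mem hf (mem_kerPow_one.1 hf1)
  rw [Prod.mk_sub_mk, sub_self, add_sub_cancel_left] at this
  exact hg (T.graph_fst_eq_zero_snd this rfl)

end RootSubspace

/-! ### Exceptional points of `H_a` -/

lemma mem_nonlocalDelta_graph {q : L2} {a : ℂ} {f g : L2} :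
    (f, g) ∈ (nonlocalDelta q a).graph ↔ ∃ (f₁ f₂ : L2) (c dp dm : ℂ), IsW22 f f₁ f₂ c c dp dm ∧
      dp - dm = a * c + inner ℂ q f ∧ g = -f₂ + c • q := by
  rw [nonlocalDelta_graph]
  constructor
  · rintro ⟨f₁, f₂, fp, fm, dp, dm, h1, h2, h3, h4⟩
    obtain rfl := sub_eq_zero.1 h2
    rw [add_self_div_two] at h3 h4
    exact ⟨f₁, f₂, fp, dp, dm, h1, h3, h4⟩
  · rintro ⟨f₁, f₂, c, dp, dm, h1, h3, h4⟩
    exact ⟨f₁, f₂, c, c, dp, dm, h1, sub_self c, by rwa [add_self_div_two],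
      by rwa [add_self_div_two]⟩

/-- Green's identity for the expression `-f'' + f(0) q`, with the defects of `f` and `g` in the
boundary conditions of `H_a` and `H_{a^*}`. -/
lemma IsW22.green_nonlocal {q f f₁ f₂ g g₁ g₂ : L2} {a c dp dm k ep em : ℂ}
    (hf : IsW22 f f₁ f₂ c c dp dm) (hg : IsW22 g g₁ g₂ k k ep em) :
    inner ℂ (-f₂ + c • q) g - inner ℂ f (-g₂ + k • q) =
      star (dp - dm - (a * c + inner ℂ q f)) * k -
        star c * (ep - em - (star a * k + inner ℂ q g)) := by
  have h := hf.green hg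
  have e : star (inner ℂ q f) = inner ℂ f q := inner_conj_symm f q
  simp only [inner_add_left, inner_add_right, inner_neg_left, inner_neg_right, inner_smul_left,
    inner_smul_right, star_sub, star_add, star_mul', e, starRingEnd_apply]
  linear_combination -h

lemma nonlocalDelta_symm {q : L2} {a : ℂ} {f F g G : L2} (hf : (f, F) ∈ (nonlocalDelta q a).graph)
    (hg : (g, G) ∈ (nonlocalDelta q (star a)).graph) : inner ℂ F g = inner ℂ f G := by
  obtain ⟨f₁, f₂, c, dp, dm, h1, h2, rfl⟩ := mem_nonlocalDelta_graph.1 hf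
  obtain ⟨g₁, g₂, k, ep, em, k1, k2, rfl⟩ := mem_nonlocalDelta_graph.1 hg
  have := h1.green_nonlocal (q := q) (a := a) k1
  rw [sub_eq_zero.2 h2, sub_eq_zero.2 k2, star_zero] at this
  linear_combination this

/-- Every boundary term in Green's identity for `f` with itself contains a factor `f(0±) = 0`,
leaving `(μ - μ^*) ‖f‖² = 0`. -/
lemma IsW22.eq_zero_of_im_ne_zero {μ : ℂ} (hμ : μ.im ≠ 0) {f f₁ : L2} {dp dm : ℂ}
    (h : IsW22 f f₁ (-(μ • f)) 0 0 dp dm) : f = 0 := by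
  have := h.green h
  simp only [inner_neg_left, inner_neg_right, inner_smul_left, inner_smul_right, star_zero,
    mul_zero, zero_mul, sub_zero] at this
  have h2 : (μ - starRingEnd ℂ μ) * inner ℂ f f = 0 := by linear_combination this
  rcases mul_eq_zero.1 h2 with h3 | h3
  · rw [sub_eq_zero, eq_comm, Complex.conj_eq_iff_im] at h3
    exact absurd h3 hμ
  · exact inner_self_eq_zero.1 h3

/-- Exceptional points of `H_a` are not real. -/
lemma im_ne_zero_of_isExceptionalPoint {q : L2} {a lam : ℂ}
    (h : IsExceptionalPoint (nonlocalDelta q a) lam) : lam.im ≠ 0 := by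
  intro him
  have hreal : starRingEnd ℂ lam = lam := Complex.conj_eq_iff_im.2 him
  obtain ⟨f, g, hg0, hg, hf⟩ := h.exists_chain
  have hg' : (g, lam • g) ∈ (nonlocalDelta q (star a)).graph := by
    obtain ⟨g₁, g₂, c, dp, dm, h1, h2, h3⟩ := mem_nonlocalDelta_graph.1 hg
    have e := h1.green_nonlocal (q := q) (a := a) h1
    rw [← h3, inner_smul_left, inner_smul_right, hreal, sub_self, sub_eq_zero.2 h2, star_zero,
      zero_mul, zero_sub, zero_eq_neg, mul_eq_zero, star_eq_zero] at e
    refine mem_nonlocalDelta_graph.2 ⟨g₁, g₂, c, dp, dm, h1, ?_, h3⟩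
    -- Either `g(0) = 0`, where the conditions for `a` and `a^*` coincide, or the defect for `a^*`
    -- vanishes.
    rcases e with e | e
    · rw [h2, e, mul_zero, mul_zero]
    · exact sub_eq_zero.1 e
  have := nonlocalDelta_symm hf hg'
  rw [inner_add_left, inner_smul_left, inner_smul_right, hreal, add_eq_left] at this
  exact hg0 (inner_self_eq_zero.1 this)

/-- Complex conjugation maps exceptional points of `H_a` to exceptional points of `H_{a^*}`. -/
lemma isExceptionalPoint_star {q : L2} {a lam : ℂ}
    (h : IsExceptionalPoint (nonlocalDelta q a) lam) :
    IsExceptionalPoint (nonlocalDelta q (star a)) (star lam) := by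
  have him := im_ne_zero_of_isExceptionalPoint h
  have him' : (star lam).im ≠ 0 := by simpa using him
  obtain ⟨f, g, hg0, hg, hf⟩ := h.exists_chain
  obtain ⟨g₁, g₂, c, dp, dm, h1, h2, h3⟩ := mem_nonlocalDelta_graph.1 hg
  have hc : star c ≠ 0 := by
    rw [Ne, star_eq_zero]
    rintro rfl
    have e : g₂ = -(lam • g) := by rw [h3]; module
    exact hg0 (IsW22.eq_zero_of_im_ne_zero him (e ▸ h1))
  -- A function continuous at `0` satisfies the boundary condition once its defect pairs to zero.
  have hbc : ∀ {u u₁ u₂ : L2} {k ep em : ℂ}, IsW22 u u₁ u₂ k k ep em →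
      inner ℂ (lam • g) u = inner ℂ g (-u₂ + k • q) →
      (u, -u₂ + k • q) ∈ (nonlocalDelta q (star a)).graph := by
    intro u u₁ u₂ k ep em hu hi
    have e := h1.green_nonlocal (q := q) (a := a) hu
    rw [← h3, hi, sub_self, sub_eq_zero.2 h2, star_zero, zero_mul, zero_sub, zero_eq_neg,
      mul_eq_zero, or_iff_right hc] at e
    exact mem_nonlocalDelta_graph.2 ⟨u₁, u₂, k, ep, em, hu, sub_eq_zero.1 e, rfl⟩
  -- The source `-q` matches the value `1` at `0`: it turns the equation into `-φ'' + φ(0) q = λ^*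
  -- φ`.
  obtain ⟨φ, φ₁, ep, em, hφ⟩ := exists_isW22_solution him' (-q) 1 1
  have eφ : -(-(star lam • φ) - -q) + (1 : ℂ) • q = star lam • φ := by module
  have gφ := hbc hφ (by rw [eφ, inner_smul_left, inner_smul_right]; rfl)
  rw [eφ] at gφ
  have hφ0 : φ ≠ 0 := by
    rintro rfl
    exact one_ne_zero (hφ.right.unique isOpen_Ioi (.zero _))
  have hgφ : inner ℂ g φ = 0 := by
    have := nonlocalDelta_symm hf gφ
    rw [inner_add_left, inner_smul_left, inner_smul_right] at this
    exact add_eq_left.1 this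
  -- The value `0` removes the nonlocal term. The boundary condition then follows from `(g, φ) = 0`.
  obtain ⟨ψ, ψ₁, sp, sm, hψ⟩ := exists_isW22_solution him' φ 0 0
  have eψ : -(-(star lam • ψ) - φ) + (0 : ℂ) • q = star lam • ψ + φ := by module
  have gψ := hbc hψ (by
    rw [eψ, inner_smul_left, inner_add_right, inner_smul_right, hgφ, add_zero]; rfl)
  rw [eψ] at gψ
  refine isExceptionalPoint_of_chain hφ0 gφ gψ fun k hk => ?_
  obtain ⟨k₁, k₂, d, tp, tm, k1, -, k3⟩ := mem_nonlocalDelta_graph.1 hk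
  refine ⟨d, ?_⟩
  -- With `d = k(0)`, the difference `k - d φ` vanishes at `0`, so the `q` terms cancel and it
  -- solves the homogeneous equation.
  have hs := k1.add (hφ.smul (-d))
  have e0 : d + -d * 1 = 0 := by ring
  have e2 : k₂ + -d • (-(star lam • φ) - -q) = -(star lam • (k + -d • φ)) := by
    have : k₂ = d • q - star lam • k := by rw [k3]; module
    rw [this]
    module
  rw [e0, e2] at hs
  have := hs.eq_zero_of_im_ne_zero him'
  rw [neg_smul, ← sub_eq_add_neg] at this
  exact sub_eq_zero.1 this

end NonlocalDelta

theorem corollary4p4 (q : NonlocalDelta.L2) (a lam₀ : ℂ)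
    (h : NonlocalDelta.IsExceptionalPoint (NonlocalDelta.nonlocalDelta q a) lam₀) :
    NonlocalDelta.IsExceptionalPoint
      (NonlocalDelta.nonlocalDelta q ((starRingEnd ℂ) a)) ((starRingEnd ℂ) lam₀) := by
  exact NonlocalDelta.isExceptionalPoint_star h
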